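/- Let $k\ge 1$ and let $\mathbf r=(r_1,\dots,r_k)$ be a vector of non-negative integers. Let $f:\mathbb R^k\to\mathbb C$ be a $k$-variate trigonometric polynomial of degree (at most) $\mathbf r$, that is, $f(\boldsymbol\theta)=\sum_{-\mathbf r\le\mathbf j\le\mathbf r}c_{\mathbf j}\,e^{\iota\langle\mathbf j,\boldsymbol\theta\rangle}$ with $\mathbf j\in\mathbb Z^k$, $c_{\mathbf j}\in\mathbb C$, $\iota^2=-1$ and $\langle\mathbf j,\boldsymbol\theta\rangle=\sum_{t=1}^k j_t\theta_t$. Suppose that all its Fourier coefficients $$\hat f_{\mathbf j}=\frac1{(2\pi)^k}\int_{[-\pi,\pi]^k}f(\boldsymbol\theta)\,e^{\iota\langle\mathbf j,\boldsymbol\theta\rangle}\,d\boldsymbol\theta,\qquad \mathbf j\in\mathbb Z^k,$$ are real. For $\mathbf n=(n_1,\dots,n_k)$ with positive integer entries put $N(\mathbf n)=n_1\cdots n_k$, let $$T_{\mathbf n}[f]=\sum_{|j_1|<n_1}\cdots\sum_{|j_k|<n_k}\hat f_{\mathbf j}\,\bigl(J_{n_1}^{j_1}\otimes\cdots\otimes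 J_{n_k}^{j_k}\bigr)$$ be the multilevel Toeplitz matrix generated by $f$, where $J_m^j$ is the $m\times m$ matrix whose $(l,h)$ entry is $1$ if $l-h=j$ and $0$ otherwise, and let $Y_{\mathbf n}=Y_{n_1}\otimes\cdots\otimes Y_{n_k}$, where $Y_m$ is the $m\times m$ anti-identity matrix (ones on the anti-diagonal, zeros elsewhere). Let $\Omega=[-2\pi,0]^k\cup[0,2\pi]^k$, let $\mathbf p=(2\pi,\dots,2\pi)\in\mathbb R^k$ and define $\psi_{|f|}:\Omega\to\mathbb R$ by $\psi_{|f|}(\boldsymbol\theta)=|f(\boldsymbol\theta)|$ for $\boldsymbol\theta\in[0,2\pi]^k$ and $\psi_{|f|}(\boldsymbol\theta)=-|f(\boldsymbol\theta+\mathbf p)|$ for $\boldsymbol\theta\in[-2\pi,0]^k$, $\boldsymbol\theta\ne\mathbf 0$. Then $\{Y_{\mathbf n}T_{\mathbf n}[f]\}_{\mathbf n}\sim_\lambda\psi_{|f|}$ over the domain $\Omega$. That is, $\Omega$ is a measurable set with Lebesgue measure $0<\mu_k(\Omega)<\infty$, $\psi_{|f|}$ is measurable, and for every continuous function $F:\mathbb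 C\to\mathbb C$ with compact support, $$\lim_{\mathbf n\to\infty}\frac1{N(\mathbf n)}\sum_{j=1}^{N(\mathbf n)}F\bigl(\lambda_j(Y_{\mathbf n}T_{\mathbf n}[f])\bigr)=\frac1{\mu_k(\Omega)}\int_{\Omega}F\bigl(\psi_{|f|}(\boldsymbol\theta)\bigr)\,d\boldsymbol\theta,$$ where $\lambda_1(A),\dots,\lambda_{N(\mathbf n)}(A)$ are the eigenvalues of $A$ with multiplicity and $\mathbf n\to\infty$ means $\min_{1\le t\le k}n_t\to\infty$. -/

import Mathlib

open scoped Real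

namespace MultilevelToeplitz

noncomputable section

/-- The set of row (and column) indices of a matrix of multilevel size `n = (n₁, …, n_k)`,
with `N(n) = n₁ ⋯ n_k` elements. -/
abbrev Idx {k : ℕ} (n : Fin k → ℕ) : Type := (t : Fin k) → Fin (n t)

/-- The size `N(n) = n₁ ⋯ n_k`. -/
def size {k : ℕ} (n : Fin k → ℕ) : ℕ := ∏ t, n t

/-- The Kronecker product `A₁ ⊗ ⋯ ⊗ A_k`; the entry at the multi-indices `l`, `h` is
`(A₁)_{l₁ h₁} ⋯ (A_k)_{l_k h_k}`. -/
def kronecker {k : ℕ} {n : Fin k → ℕ} (A : (t : Fin k) → Matrix (Fin (n t)) (Fin (n t)) ℂ) :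
    Matrix (Idx n) (Idx n) ℂ :=
  Matrix.of fun l h => ∏ t, A t (l t) (h t)

/-- The `m × m` matrix `J_m^j`, whose `(l, h)` entry is `1` if `l - h = j` and `0` otherwise. -/
def shiftMatrix (m : ℕ) (j : ℤ) : Matrix (Fin m) (Fin m) ℂ :=
  Matrix.of fun l h => if (l : ℤ) - (h : ℤ) = j then 1 else 0

/-- The `m × m` anti-identity matrix `Y_m`: ones exactly on the anti-diagonal. -/
def antiIdentity (m : ℕ) : Matrix (Fin m) (Fin m) ℂ :=
  Matrix.of fun l h => if h = l.rev then 1 else 0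

/-- The multilevel anti-identity `Y_n = Y_{n₁} ⊗ ⋯ ⊗ Y_{n_k}`. -/
def multiAntiIdentity {k : ℕ} (n : Fin k → ℕ) : Matrix (Idx n) (Idx n) ℂ :=
  kronecker fun t => antiIdentity (n t)

/-- The pairing `⟨j, θ⟩ = ∑ t, j_t θ_t`. -/
def pairing {k : ℕ} (j : Fin k → ℤ) (θ : Fin k → ℝ) : ℝ := ∑ t, (j t : ℝ) * θ t

/-- The Fourier coefficient `(2π)^{-k} ∫_{[-π,π]^k} f(θ) e^{i⟨j,θ⟩} dθ`. -/
def fourierCoefficient {k : ℕ} (f : (Fin k → ℝ) → ℂ) (j : Fin k → ℤ) : ℂ :=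
  (1 / (2 * (π : ℂ)) ^ k) *
    ∫ θ in Set.Icc (fun _ : Fin k => -π) (fun _ : Fin k => π),
      f θ * Complex.exp (Complex.I * (pairing j θ : ℂ))

/-- The multilevel Toeplitz matrix generated by `f`,
`T_n[f] = ∑_{|j₁| < n₁} ⋯ ∑_{|j_k| < n_k} f̂_j (J_{n₁}^{j₁} ⊗ ⋯ ⊗ J_{n_k}^{j_k})`. -/
def toeplitz {k : ℕ} (f : (Fin k → ℝ) → ℂ) (n : Fin k → ℕ) : Matrix (Idx n) (Idx n) ℂ :=
  ∑ j ∈ Fintype.piFinset fun t : Fin k => Finset.Ioo (-(n t : ℤ)) (n t : ℤ),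
    fourierCoefficient f j • kronecker fun t => shiftMatrix (n t) (j t)

/-- `f` is a `k`-variate trigonometric polynomial of degree (at most) `r = (r₁, …, r_k)`:
`f(θ) = ∑_{-r ≤ j ≤ r} c_j e^{i⟨j,θ⟩}` with complex coefficients `c_j`. -/
def IsTrigPolynomial {k : ℕ} (r : Fin k → ℕ) (f : (Fin k → ℝ) → ℂ) : Prop :=
  ∃ c : (Fin k → ℤ) → ℂ, ∀ θ : Fin k → ℝ,
    f θ = ∑ j ∈ Fintype.piFinset fun t : Fin k => Finset.Icc (-(r t : ℤ)) (r t : ℤ),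
      c j * Complex.exp (Complex.I * (pairing j θ : ℂ))

/-- All Fourier coefficients of `f` are real. -/
def HasRealFourierCoefficients {k : ℕ} (f : (Fin k → ℝ) → ℂ) : Prop :=
  ∀ j : Fin k → ℤ, ∃ a : ℝ, fourierCoefficient f j = (a : ℂ)

/-- The domain `[-2π, 0]^k ∪ [0, 2π]^k`. -/
def psiDomain (k : ℕ) : Set (Fin k → ℝ) :=
  Set.Icc (fun _ => -(2 * π)) (fun _ => 0) ∪ Set.Icc (fun _ => 0) (fun _ => 2 * π)

open Classical in
/-- The function `ψ_g` on `psiDomain k`: `g(θ)` on `[0, 2π]^k`, and `-g(θ + (2π, …, 2π))` on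
the rest of the domain, that is on `[-2π, 0]^k` without the origin (for `k ≥ 1`). The values
outside `psiDomain k` play no role. -/
def psi {k : ℕ} (g : (Fin k → ℝ) → ℝ) (θ : Fin k → ℝ) : ℝ :=
  if θ ∈ Set.Icc (fun _ : Fin k => (0 : ℝ)) (fun _ => 2 * π) then g θ
  else -g (fun t => θ t + 2 * π)

/-- `{A_n}_n ∼_λ g` over the domain `D`. Here `D ⊆ ℝ^d` is a Lebesgue measurable set with
`0 < μ_d(D) < ∞`, `g` is Lebesgue measurable on `D`, and for every continuous `F : ℂ → ℂ` of
compact support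
`(1 / N(n)) ∑_j F(λ_j(A_n)) → (1 / μ_d(D)) ∫_D F(g(x)) dx` as `n → ∞`.
The eigenvalues `λ_j(A_n)` are the roots of the characteristic polynomial, with multiplicity.
The filter `Filter.atTop` on `Fin k → ℕ` (product order) says that `min_t n_t → ∞`. -/
def HasEigenvalueDistribution {k d : ℕ} (A : (n : Fin k → ℕ) → Matrix (Idx n) (Idx n) ℂ)
    (g : (Fin d → ℝ) → ℂ) (D : Set (Fin d → ℝ)) : Prop :=
  MeasureTheory.NullMeasurableSet D ∧
  0 < MeasureTheory.volume D ∧ MeasureTheory.volume D < ⊤ ∧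
  AEMeasurable g (MeasureTheory.volume.restrict D) ∧
  ∀ F : ℂ → ℂ, Continuous F → HasCompactSupport F →
    Filter.Tendsto
      (fun n : Fin k → ℕ => (1 / (size n : ℂ)) * ((A n).charpoly.roots.map F).sum)
      Filter.atTop
      (nhds ((1 / ((MeasureTheory.volume D).toReal : ℂ)) * ∫ x in D, F (g x)))

end

end MultilevelToeplitz

/-!
The eigenvalue distribution is obtained by the method of moments. Write `T` for the Toeplitz matrix
`T_n[f]` and `Y` for the multilevel anti-identity. Since the Fourier coefficients are real, `Y T` is
a real multilevel Hankel matrix, hence Hermitian; its eigenvalues are real, and they are bounded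
uniformly in `n` by the sum of the absolute values of the coefficients of `f`, a bound for the row
sums (`abs_eigenvalues_le_of_row_sum_le`). By the Weierstrass theorem it therefore suffices to treat
the test functions `x ^ m` (`tendsto_average_of_moments`), that is, the normalized traces of
`(Y T) ^ m`.

The symmetry of `Y T` gives `(Y T)² = Tᵀ T`. A product of banded Toeplitz matrices is again banded,
and away from the boundary of the index box it is the Toeplitz matrix of the product of the symbols.
This is the content of `IsEssentiallyToeplitz` and its stability under multiplication.

* For `m = 2 s` the trace is that of `(Tᵀ T) ^ s`. All but a vanishing fraction of the diagonal
  entries equal the constant coefficient of `(conj f · f) ^ s`, which is the mean of `|f| ^ (2 s)`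
  (`IsEssentiallyToeplitz.tendsto_trace`, `integral_evalAt`).
* For `m = 2 s + 1` the matrix is `Y` times the banded matrix `T (Tᵀ T) ^ s`. The flip moves the band
  to the antidiagonal, so that only a vanishing fraction of the diagonal entries is nonzero, and the
  limit is `0` (`IsEssentiallyToeplitz.tendsto_trace_antiIdentity_mul`).

These limits are the moments of `ψ_{|f|}`, which takes the values `|f|` and `-|f|` on two cubes of the
same volume (`moment_psi`).
-/

namespace MultilevelToeplitz

/-! ### Matrix sequences that are Toeplitz away from the boundary -/

/-- The multi-index `l` keeps a distance of at least `R` from every face of the box `Idx n`. -/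
def IsInterior {k : ℕ} {n : Fin k → ℕ} (R : ℕ) (l : Idx n) : Prop :=
  ∀ t, R ≤ (l t : ℕ) ∧ (l t : ℕ) + R < n t

/-- The shift `h - l ∈ ℤ^k` between two multi-indices. -/
def offset {k : ℕ} {n : Fin k → ℕ} (l h : Idx n) : Fin k → ℤ := fun t => (h t : ℤ) - (l t : ℤ)

/-- The matrix sequence `A` is banded with bandwidth `R`, has row sums bounded by `C`, and agrees
with the Toeplitz matrices of the Laurent polynomial `a` in all rows at distance at least `R`
from the boundary: there the `(l, h)` entry is the coefficient of `a` at `h - l`. The exponents of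
`a` lie in `[-R, R]^k`. -/
structure IsEssentiallyToeplitz {k : ℕ} (A : (n : Fin k → ℕ) → Matrix (Idx n) (Idx n) ℂ)
    (a : AddMonoidAlgebra ℂ (Fin k → ℤ)) (R : ℕ) (C : ℝ) : Prop where
  abs_le_of_coeff_ne_zero : ∀ j, a.coeff j ≠ 0 → ∀ t, |j t| ≤ R
  apply_interior : ∀ (n : Fin k → ℕ) (l h : Idx n), IsInterior R l →
    A n l h = a.coeff (offset l h)
  banded : ∀ (n : Fin k → ℕ) (l h : Idx n), A n l h ≠ 0 → ∀ t, |offset l h t| ≤ R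
  row_sum_le : ∀ (n : Fin k → ℕ) (l : Idx n), ∑ h, ‖A n l h‖ ≤ C

lemma IsEssentiallyToeplitz.norm_apply_le {k : ℕ}
    {A : (n : Fin k → ℕ) → Matrix (Idx n) (Idx n) ℂ} {a : AddMonoidAlgebra ℂ (Fin k → ℤ)}
    {R : ℕ} {C : ℝ} (hA : IsEssentiallyToeplitz A a R C) (n : Fin k → ℕ) (l h : Idx n) :
    ‖A n l h‖ ≤ C :=
  (Finset.single_le_sum (f := fun h => ‖A n l h‖) (fun _ _ => norm_nonneg _)
    (Finset.mem_univ h)).trans (hA.row_sum_le n l)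

lemma exists_offset_eq {k : ℕ} {n : Fin k → ℕ} {R : ℕ} {l : Idx n} (hl : IsInterior R l)
    {j : Fin k → ℤ} (hj : ∀ t, |j t| ≤ R) : ∃ i : Idx n, offset l i = j := by
  have h1 : ∀ t, 0 ≤ (l t : ℤ) + j t ∧ (l t : ℤ) + j t < n t := fun t => by
    have := hl t
    have := abs_le.1 (hj t)
    omega
  refine ⟨fun t => ⟨((l t : ℤ) + j t).toNat, by have := h1 t; omega⟩, funext fun t => ?_⟩
  have := h1 t
  simp only [offset]
  omega

lemma offset_injective {k : ℕ} {n : Fin k → ℕ} (l : Idx n) :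
    Function.Injective (offset l) := by
  intro i i' h
  funext t
  have := congrFun h t
  simp only [offset] at this
  exact Fin.ext (by omega)

lemma offset_add {k : ℕ} {n : Fin k → ℕ} (l i h : Idx n) (t : Fin k) :
    offset l h t = offset l i t + offset i h t := by
  simp only [offset]; ring

lemma coeff_mul_eq_sum {k : ℕ} (a b : AddMonoidAlgebra ℂ (Fin k → ℤ)) (g : Fin k → ℤ) :
    (a * b).coeff g = ∑ j ∈ a.coeff.support, a.coeff j * b.coeff (-j + g) := by
  conv_lhs => rw [← AddMonoidAlgebra.sum_coeff_single a]
  simp only [Finsupp.sum, Finset.sum_mul, AddMonoidAlgebra.coeff_sum, Finsupp.finsetSum_apply,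
    AddMonoidAlgebra.coeff_single_mul_apply]

/-- If the row `l` is far enough from the boundary, then every index that contributes to the
convolution `a * b` stays in the box. -/
lemma sum_offset_eq_coeff_mul {k : ℕ} {n : Fin k → ℕ} {R : ℕ} {l : Idx n} (hl : IsInterior R l)
    (h : Idx n) {a : AddMonoidAlgebra ℂ (Fin k → ℤ)} (b : AddMonoidAlgebra ℂ (Fin k → ℤ))
    (ha : ∀ j, a.coeff j ≠ 0 → ∀ t, |j t| ≤ R) :
    ∑ i : Idx n, a.coeff (offset l i) * b.coeff (offset i h) = (a * b).coeff (offset l h) := by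
  classical
  rw [coeff_mul_eq_sum]
  have hsub : a.coeff.support ⊆ Finset.univ.image (offset l) := by
    intro j hj
    obtain ⟨i, hi⟩ := exists_offset_eq hl (ha j (Finsupp.mem_support_iff.1 hj))
    exact Finset.mem_image.2 ⟨i, Finset.mem_univ _, hi⟩
  rw [Finset.sum_subset hsub fun j _ hj => by rw [Finsupp.notMem_support_iff.1 hj, zero_mul],
    Finset.sum_image (fun _ _ _ _ e => offset_injective l e)]
  refine Finset.sum_congr rfl fun i _ => ?_
  congr 2
  funext t
  simp only [Pi.add_apply, Pi.neg_apply, offset]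
  ring

lemma IsEssentiallyToeplitz.one (k : ℕ) :
    IsEssentiallyToeplitz (fun n : Fin k → ℕ => (1 : Matrix (Idx n) (Idx n) ℂ)) 1 0 1 where
  abs_le_of_coeff_ne_zero j hj t := by
    rw [AddMonoidAlgebra.one_def, AddMonoidAlgebra.coeff_single, Finsupp.single_apply] at hj
    have : 0 = j := by by_contra h; simp [h] at hj
    simp [← this]
  apply_interior n l h _ := by
    have : (0 = offset l h) ↔ l = h := by
      constructor
      · intro e
        refine funext fun t => Fin.ext ?_
        have := congrFun e t
        simp only [offset, Pi.zero_apply] at this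
        omega
      · rintro rfl; funext t; simp [offset]
    rw [AddMonoidAlgebra.one_def, AddMonoidAlgebra.coeff_single, Finsupp.single_apply,
      Matrix.one_apply]
    simp only [this]
  banded n l h hne t := by
    have : l = h := by by_contra e; exact hne (Matrix.one_apply_ne e)
    simp [offset, this]
  row_sum_le n l := by
    simp only [Matrix.one_apply, apply_ite norm, norm_one, norm_zero, Finset.sum_ite_eq,
      Finset.mem_univ, if_true, le_refl]

lemma IsEssentiallyToeplitz.mul {k : ℕ} {A B : (n : Fin k → ℕ) → Matrix (Idx n) (Idx n) ℂ}
    {a b : AddMonoidAlgebra ℂ (Fin k → ℤ)} {R S : ℕ} {C D : ℝ} (hD : 0 ≤ D)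
    (hA : IsEssentiallyToeplitz A a R C) (hB : IsEssentiallyToeplitz B b S D) :
    IsEssentiallyToeplitz (fun n => A n * B n) (a * b) (R + S) (C * D) where
  abs_le_of_coeff_ne_zero j hj t := by
    by_contra hlt
    apply hj
    rw [coeff_mul_eq_sum]
    refine Finset.sum_eq_zero fun i hi => ?_
    rw [mul_eq_zero]
    by_contra hne
    push Not at hne
    have h1 := hA.abs_le_of_coeff_ne_zero i hne.1 t
    have h2 := hB.abs_le_of_coeff_ne_zero _ hne.2 t
    simp only [Pi.add_apply, Pi.neg_apply, abs_le] at h1 h2 hlt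
    push_cast at hlt
    omega
  apply_interior n l h hl := by
    have hlR : IsInterior R l := fun t => by have := hl t; omega
    rw [Matrix.mul_apply, ← sum_offset_eq_coeff_mul hlR h b hA.abs_le_of_coeff_ne_zero]
    refine Finset.sum_congr rfl fun i _ => ?_
    rw [hA.apply_interior n l i hlR]
    by_cases hz : a.coeff (offset l i) = 0
    · rw [hz, zero_mul, zero_mul]
    · rw [hB.apply_interior n i h fun t => ?_]
      have h1 := hA.abs_le_of_coeff_ne_zero _ hz t
      have h2 := hl t
      simp only [offset, abs_le] at h1
      omega
  banded n l h hne t := by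
    obtain ⟨i, -, hi⟩ := Finset.exists_ne_zero_of_sum_ne_zero (by rwa [Matrix.mul_apply] at hne)
    have h1 := hA.banded n l i (left_ne_zero_of_mul hi) t
    have h2 := hB.banded n i h (right_ne_zero_of_mul hi) t
    rw [offset_add l i h]
    push_cast
    exact (abs_add_le _ _).trans (add_le_add h1 h2)
  row_sum_le n l := by
    calc ∑ h, ‖(A n * B n) l h‖ ≤ ∑ h, ∑ i, ‖A n l i‖ * ‖B n i h‖ :=
          Finset.sum_le_sum fun h _ => by
            rw [Matrix.mul_apply]
            exact (norm_sum_le _ _).trans (le_of_eq (by simp only [norm_mul]))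
      _ = ∑ i, ‖A n l i‖ * ∑ h, ‖B n i h‖ := by
          rw [Finset.sum_comm]; simp only [Finset.mul_sum]
      _ ≤ ∑ i, ‖A n l i‖ * D :=
          Finset.sum_le_sum fun i _ =>
            mul_le_mul_of_nonneg_left (hB.row_sum_le n i) (norm_nonneg _)
      _ ≤ C * D := by
          rw [← Finset.sum_mul]
          exact mul_le_mul_of_nonneg_right (hA.row_sum_le n l) hD

lemma IsEssentiallyToeplitz.pow {k : ℕ} {A : (n : Fin k → ℕ) → Matrix (Idx n) (Idx n) ℂ}
    {a : AddMonoidAlgebra ℂ (Fin k → ℤ)} {R : ℕ} {C : ℝ} (hC : 0 ≤ C)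
    (hA : IsEssentiallyToeplitz A a R C) (m : ℕ) :
    IsEssentiallyToeplitz (fun n => A n ^ m) (a ^ m) (m * R) (C ^ m) := by
  induction m with
  | zero => simpa using IsEssentiallyToeplitz.one k
  | succ m ih => simpa only [pow_succ, Nat.succ_mul] using ih.mul hC hA

/-! ### Traces -/

/-- Fixing one coordinate to a finite set `S` leaves the fraction `|S| / n_t` of all indices. -/
lemma card_filter_mem_coord {k : ℕ} {n : Fin k → ℕ} (t : Fin k) (S : Finset (Fin (n t))) :
    (Finset.univ.filter fun l : Idx n => l t ∈ S).card * n t = S.card * size n := by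
  classical
  have : (Finset.univ.filter fun l : Idx n => l t ∈ S)
      = Fintype.piFinset (Function.update (fun s => (Finset.univ : Finset (Fin (n s)))) t S) := by
    ext l
    simp only [Finset.mem_filter, Finset.mem_univ, true_and, Fintype.mem_piFinset]
    constructor
    · intro h s
      by_cases hs : s = t
      · subst hs; simpa using h
      · simp [Function.update_of_ne hs]
    · intro h
      simpa using h t
  rw [this, Fintype.card_piFinset, size, ← Finset.mul_prod_erase _ _ (Finset.mem_univ t),
    ← Finset.mul_prod_erase _ (fun t => n t) (Finset.mem_univ t), Function.update_self]
  rw [Finset.prod_congr rfl fun s hs => by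
    rw [Function.update_of_ne (Finset.ne_of_mem_erase hs), Finset.card_univ, Fintype.card_fin]]
  ring

lemma tendsto_const_div_coord {k : ℕ} (c : ℝ) (t : Fin k) :
    Filter.Tendsto (fun n : Fin k → ℕ => c / (n t : ℝ)) Filter.atTop (nhds 0) := by
  have h : Filter.Tendsto (fun n : Fin k → ℕ => n t) Filter.atTop Filter.atTop :=
    Filter.tendsto_atTop.2 fun b =>
      Filter.eventually_atTop.2 ⟨fun _ => b, fun n hn => hn t⟩
  exact (tendsto_const_div_atTop_nhds_zero_nat c).comp h

lemma eventually_pos (k : ℕ) : ∀ᶠ n : Fin k → ℕ in Filter.atTop, ∀ t, 0 < n t :=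
  Filter.eventually_atTop.2 ⟨fun _ => 1, fun _ hn t => hn t⟩

lemma size_pos {k : ℕ} {n : Fin k → ℕ} (hn : ∀ t, 0 < n t) : 0 < size n :=
  Finset.prod_pos fun t _ => hn t

open Classical in
lemma card_not_interior_le {k : ℕ} {n : Fin k → ℕ} (hn : ∀ t, 0 < n t) (R : ℕ) :
    ((Finset.univ.filter fun l : Idx n => ¬ IsInterior R l).card : ℝ)
      ≤ size n * ∑ t, (2 * R : ℝ) / n t := by
  let S : (t : Fin k) → Finset (Fin (n t)) := fun t =>
    Finset.univ.filter fun x : Fin (n t) => (x : ℕ) < R ∨ n t ≤ (x : ℕ) + R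
  have hS : ∀ t, (S t).card ≤ 2 * R := fun t => by
    have h1 : ((S t).image fun x : Fin (n t) => (x : ℕ))
        ⊆ Finset.range R ∪ Finset.Ico (n t - R) (n t) := by
      intro x hx
      simp only [S, Finset.mem_image, Finset.mem_filter, Finset.mem_univ, true_and] at hx
      obtain ⟨y, hy, rfl⟩ := hx
      simp only [Finset.mem_union, Finset.mem_range, Finset.mem_Ico]
      omega
    have h2 := (Finset.card_le_card h1).trans (Finset.card_union_le _ _)
    rw [Finset.card_image_of_injective _ Fin.val_injective, Finset.card_range, Nat.card_Ico] at h2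
    omega
  have hsub : (Finset.univ.filter fun l : Idx n => ¬ IsInterior R l)
      ⊆ Finset.univ.biUnion fun t => Finset.univ.filter fun l : Idx n => l t ∈ S t := by
    intro l hl
    simp only [IsInterior, Finset.mem_filter, Finset.mem_univ, true_and, not_forall] at hl
    obtain ⟨t, ht⟩ := hl
    simp only [S, Finset.mem_biUnion, Finset.mem_filter, Finset.mem_univ, true_and]
    exact ⟨t, by omega⟩
  have h3 := (Finset.card_le_card hsub).trans Finset.card_biUnion_le
  calc ((Finset.univ.filter fun l : Idx n => ¬ IsInterior R l).card : ℝ)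
      ≤ ∑ t, ((Finset.univ.filter fun l : Idx n => l t ∈ S t).card : ℝ) := by exact_mod_cast h3
    _ ≤ ∑ t, (size n : ℝ) * ((2 * R : ℝ) / n t) := Finset.sum_le_sum fun t _ => by
        have h4 : (((Finset.univ.filter fun l : Idx n => l t ∈ S t).card : ℝ)) * n t
            = (S t).card * size n := by exact_mod_cast card_filter_mem_coord t (S t)
        have h5 : ((S t).card : ℝ) ≤ 2 * R := by exact_mod_cast hS t
        have h6 : (0 : ℝ) < n t := by exact_mod_cast hn t
        rw [← mul_div_assoc, le_div_iff₀ h6, h4, mul_comm]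
        exact mul_le_mul_of_nonneg_left h5 (Nat.cast_nonneg _)
    _ = _ := by rw [Finset.mul_sum]

/-- The normalized traces converge to the constant coefficient: all but a vanishing fraction of
the diagonal entries are equal to it. -/
lemma IsEssentiallyToeplitz.tendsto_trace {k : ℕ}
    {A : (n : Fin k → ℕ) → Matrix (Idx n) (Idx n) ℂ} {a : AddMonoidAlgebra ℂ (Fin k → ℤ)}
    {R : ℕ} {C : ℝ} (hA : IsEssentiallyToeplitz A a R C) :
    Filter.Tendsto (fun n => (1 / (size n : ℂ)) * (A n).trace) Filter.atTop
      (nhds (a.coeff 0)) := by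
  classical
  rw [tendsto_iff_norm_sub_tendsto_zero]
  have hlim : Filter.Tendsto
      (fun n : Fin k → ℕ => (∑ t, (2 * R : ℝ) / n t) * (C + ‖a.coeff 0‖)) Filter.atTop
      (nhds 0) := by
    have := (tendsto_finsetSum Finset.univ fun t _ =>
      tendsto_const_div_coord (2 * R : ℝ) (t : Fin k)).mul_const (C + ‖a.coeff 0‖)
    simpa using this
  refine squeeze_zero' (Filter.Eventually.of_forall fun _ => norm_nonneg _) ?_ hlim
  filter_upwards [eventually_pos k] with n hn
  have hN : (0 : ℝ) < size n := by exact_mod_cast size_pos hn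
  have hN' : (size n : ℂ) ≠ 0 := by exact_mod_cast hN.ne'
  have hcard : ∑ _l : Idx n, a.coeff 0 = size n * a.coeff 0 := by
    simp [size, Fintype.card_pi]
  have e : (1 / (size n : ℂ)) * (A n).trace - a.coeff 0
      = (1 / (size n : ℂ)) * ∑ l : Idx n, (A n l l - a.coeff 0) := by
    rw [Finset.sum_sub_distrib, hcard]
    simp only [Matrix.trace, Matrix.diag_apply]
    field_simp
  have hsum : ‖∑ l : Idx n, (A n l l - a.coeff 0)‖
      ≤ (Finset.univ.filter fun l : Idx n => ¬ IsInterior R l).card * (C + ‖a.coeff 0‖) := by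
    rw [← Finset.sum_filter_add_sum_filter_not Finset.univ (fun l : Idx n => IsInterior R l),
      Finset.sum_eq_zero, zero_add]
    · refine (norm_sum_le_of_le _ (f := fun l => A n l l - a.coeff 0)
        (n := fun _ => C + ‖a.coeff 0‖) fun l _ => ?_).trans
        (by rw [Finset.sum_const, nsmul_eq_mul])
      exact (norm_sub_le _ _).trans (by gcongr; exact hA.norm_apply_le n l l)
    · intro l hl
      rw [hA.apply_interior n l l (Finset.mem_filter.1 hl).2, sub_eq_zero]
      congr 1
      funext t
      simp [offset]
  have hC : 0 ≤ C + ‖a.coeff 0‖ := by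
    let l : Idx n := fun t => ⟨0, hn t⟩
    exact add_nonneg ((norm_nonneg _).trans (hA.norm_apply_le n l l)) (norm_nonneg _)
  rw [e, norm_mul, norm_div, norm_one, Complex.norm_natCast]
  calc 1 / (size n : ℝ) * ‖∑ l : Idx n, (A n l l - a.coeff 0)‖
      ≤ 1 / (size n : ℝ) * ((size n * ∑ t, (2 * R : ℝ) / n t) * (C + ‖a.coeff 0‖)) := by
        gcongr
        exact hsum.trans (mul_le_mul_of_nonneg_right (card_not_interior_le hn R) hC)
    _ = _ := by field_simp

lemma multiAntiIdentity_mul_apply {k : ℕ} {n : Fin k → ℕ} (B : Matrix (Idx n) (Idx n) ℂ)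
    (l h : Idx n) : (multiAntiIdentity n * B) l h = B (fun t => (l t).rev) h := by
  classical
  rw [Matrix.mul_apply, Finset.sum_eq_single fun t => (l t).rev]
  · simp [multiAntiIdentity, kronecker, antiIdentity]
  · intro i _ hi
    obtain ⟨t, ht⟩ := Function.ne_iff.1 hi
    have : multiAntiIdentity n l i = 0 := by
      simp only [multiAntiIdentity, kronecker, antiIdentity, Matrix.of_apply]
      exact Finset.prod_eq_zero (Finset.mem_univ t) (if_neg ht)
    rw [this, zero_mul]
  · simp

/-- Flipping a banded matrix moves its band across the diagonal, which it meets in a vanishing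
fraction of the indices only. -/
lemma IsEssentiallyToeplitz.tendsto_trace_antiIdentity_mul {k : ℕ} (hk : 1 ≤ k)
    {A : (n : Fin k → ℕ) → Matrix (Idx n) (Idx n) ℂ} {a : AddMonoidAlgebra ℂ (Fin k → ℤ)}
    {R : ℕ} {C : ℝ} (hA : IsEssentiallyToeplitz A a R C) :
    Filter.Tendsto (fun n => (1 / (size n : ℂ)) * (multiAntiIdentity n * A n).trace) Filter.atTop
      (nhds 0) := by
  classical
  let t : Fin k := ⟨0, hk⟩
  rw [tendsto_zero_iff_norm_tendsto_zero]
  refine squeeze_zero' (Filter.Eventually.of_forall fun _ => norm_nonneg _) ?_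
    (tendsto_const_div_coord ((2 * R + 1 : ℕ) * C) t)
  filter_upwards [eventually_pos k] with n hn
  have hN : (0 : ℝ) < size n := by exact_mod_cast size_pos hn
  have hnt : (0 : ℝ) < n t := by exact_mod_cast hn t
  have hC : 0 ≤ C := by
    let l : Idx n := fun t => ⟨0, hn t⟩
    exact (norm_nonneg _).trans (hA.norm_apply_le n l l)
  let S : Finset (Fin (n t)) :=
    Finset.univ.filter fun x : Fin (n t) => |(x : ℤ) - (x.rev : ℤ)| ≤ R
  have hS : S.card ≤ 2 * R + 1 := by
    -- The values `2 x - (n_t - 1)`, for `x` in `S`, are distinct elements of `[-R, R]`.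
    have h1 : (S.image fun x : Fin (n t) => (x : ℤ) - (x.rev : ℤ)) ⊆ Finset.Icc (-(R : ℤ)) R := by
      intro x hx
      simp only [S, Finset.mem_image, Finset.mem_filter, Finset.mem_univ, true_and] at hx
      obtain ⟨y, hy, rfl⟩ := hx
      exact Finset.mem_Icc.2 (abs_le.1 hy)
    have h2 := Finset.card_le_card h1
    rw [Finset.card_image_of_injective, Int.card_Icc] at h2
    · omega
    · intro x y hxy
      simp only [Fin.val_rev] at hxy
      exact Fin.ext (by omega)
  have hsum : ‖(multiAntiIdentity n * A n).trace‖
      ≤ (Finset.univ.filter fun l : Idx n => l t ∈ S).card * C := by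
    simp only [Matrix.trace, Matrix.diag_apply, multiAntiIdentity_mul_apply]
    rw [← Finset.sum_filter_add_sum_filter_not Finset.univ (fun l : Idx n => l t ∈ S),
      Finset.sum_eq_zero (s := Finset.univ.filter fun l : Idx n => ¬ l t ∈ S), add_zero]
    · exact (norm_sum_le_of_le _ (n := fun _ => C)
        fun l _ => hA.norm_apply_le n _ _).trans (by simp)
    · intro l hl
      by_contra hne
      refine (Finset.mem_filter.1 hl).2 ?_
      simpa [S, offset] using hA.banded n _ _ hne t
  have h4 : (((Finset.univ.filter fun l : Idx n => l t ∈ S).card : ℝ)) * n t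
      = S.card * size n := by exact_mod_cast card_filter_mem_coord t S
  rw [norm_mul, norm_div, norm_one, Complex.norm_natCast, one_div, inv_mul_le_iff₀ hN,
    ← mul_div_assoc, le_div_iff₀ hnt]
  calc ‖(multiAntiIdentity n * A n).trace‖ * n t
      ≤ (Finset.univ.filter fun l : Idx n => l t ∈ S).card * C * n t := by gcongr
    _ = S.card * (size n * C) := by rw [mul_right_comm, h4]; ring
    _ ≤ (2 * R + 1 : ℕ) * (size n * C) := by gcongr
    _ = _ := by ring

/-! ### Laurent polynomials as trigonometric polynomials -/

/-- Evaluation of a Laurent polynomial `∑ a_j z^j` at `z = (e^{iθ₁}, …, e^{iθ_k})`, as an algebra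
homomorphism: products of symbols correspond to convolutions of coefficients. -/
noncomputable def evalAt {k : ℕ} (θ : Fin k → ℝ) :
    AddMonoidAlgebra ℂ (Fin k → ℤ) →ₐ[ℂ] ℂ :=
  AddMonoidAlgebra.lift ℂ ℂ (Fin k → ℤ)
    { toFun := fun j => Complex.exp (Complex.I * (pairing j.toAdd θ : ℂ))
      map_one' := by simp [pairing]
      map_mul' := fun i j => by
        rw [← Complex.exp_add, ← mul_add, ← Complex.ofReal_add]
        simp only [pairing, toAdd_mul, Pi.add_apply, Int.cast_add, add_mul,
          Finset.sum_add_distrib] }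

lemma evalAt_single {k : ℕ} (θ : Fin k → ℝ) (j : Fin k → ℤ) (c : ℂ) :
    evalAt θ (AddMonoidAlgebra.single j c)
      = c * Complex.exp (Complex.I * (pairing j θ : ℂ)) := by
  simp [evalAt]

lemma continuous_evalAt {k : ℕ} (b : AddMonoidAlgebra ℂ (Fin k → ℤ)) :
    Continuous fun θ : Fin k → ℝ => evalAt θ b := by
  induction b using AddMonoidAlgebra.induction_linear with
  | zero => simp only [map_zero]; exact continuous_const
  | add x y hx hy => simp only [map_add]; exact hx.add hy
  | single m r => simp only [evalAt_single, pairing]; fun_prop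

lemma norm_evalAt_le {k : ℕ} (b : AddMonoidAlgebra ℂ (Fin k → ℤ)) (θ : Fin k → ℝ) :
    ‖evalAt θ b‖ ≤ ∑ j ∈ b.coeff.support, ‖b.coeff j‖ := by
  conv_lhs => rw [← AddMonoidAlgebra.sum_coeff_single b]
  simp only [Finsupp.sum, map_sum, evalAt_single]
  refine norm_sum_le_of_le _ fun j _ => ?_
  rw [norm_mul, mul_comm Complex.I, Complex.norm_exp_ofReal_mul_I, mul_one]

lemma integral_exp_int_mul (s : ℝ) (m : ℤ) :
    ∫ x in Set.Icc s (s + 2 * π), Complex.exp (Complex.I * ((m * x : ℝ) : ℂ))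
      = if m = 0 then (2 * π : ℂ) else 0 := by
  have hle : s ≤ s + 2 * π := by linarith [Real.pi_pos]
  rw [MeasureTheory.integral_Icc_eq_integral_Ioc, ← intervalIntegral.integral_of_le hle]
  split_ifs with hm
  · simp [hm]
  · have hc : Complex.I * (m : ℂ) ≠ 0 := mul_ne_zero Complex.I_ne_zero (by exact_mod_cast hm)
    have h := integral_exp_mul_complex (a := s) (b := s + 2 * π) hc
    have hper : Complex.exp (Complex.I * m * ((s + 2 * π : ℝ) : ℂ))
        = Complex.exp (Complex.I * m * (s : ℂ)) := by
      rw [Complex.exp_eq_exp_iff_exists_int]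
      exact ⟨m, by push_cast; ring⟩
    rw [hper, sub_self, zero_div] at h
    rw [← h]
    congr 1
    funext x
    push_cast
    ring_nf

lemma integral_exp_pairing {k : ℕ} (s : ℝ) (j : Fin k → ℤ) :
    ∫ θ in Set.Icc (fun _ : Fin k => s) (fun _ => s + 2 * π),
      Complex.exp (Complex.I * (pairing j θ : ℂ)) = if j = 0 then (2 * π : ℂ) ^ k else 0 := by
  have h1 : ∀ θ : Fin k → ℝ, Complex.exp (Complex.I * (pairing j θ : ℂ))
      = ∏ t, Complex.exp (Complex.I * ((j t * θ t : ℝ) : ℂ)) := fun θ => by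
    rw [← Complex.exp_sum, pairing, Complex.ofReal_sum, Finset.mul_sum]
  simp only [h1]
  rw [← Set.pi_univ_Icc, MeasureTheory.volume_pi, MeasureTheory.Measure.restrict_pi_pi,
    MeasureTheory.integral_fintype_prod_eq_prod
      (fun t (x : ℝ) => Complex.exp (Complex.I * ((j t * x : ℝ) : ℂ)))]
  simp only [integral_exp_int_mul]
  split_ifs with hj
  · simp [hj]
  · obtain ⟨t, ht⟩ := Function.ne_iff.1 hj
    exact Finset.prod_eq_zero (Finset.mem_univ t) (if_neg ht)

/-- The mean value over any period cube is the constant coefficient. -/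
lemma integral_evalAt {k : ℕ} (s : ℝ) (b : AddMonoidAlgebra ℂ (Fin k → ℤ)) :
    ∫ θ in Set.Icc (fun _ : Fin k => s) (fun _ => s + 2 * π), evalAt θ b
      = (2 * π : ℂ) ^ k * b.coeff 0 := by
  induction b using AddMonoidAlgebra.induction_linear with
  | zero => simp
  | add x y hx hy =>
    simp only [map_add]
    rw [MeasureTheory.integral_add, hx, hy]
    · simp [mul_add]
    · exact (continuous_evalAt x).continuousOn.integrableOn_compact isCompact_Icc
    · exact (continuous_evalAt y).continuousOn.integrableOn_compact isCompact_Icc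
  | single m r =>
    simp only [evalAt_single]
    rw [MeasureTheory.integral_const_mul, integral_exp_pairing, AddMonoidAlgebra.coeff_single,
      Finsupp.single_apply]
    split_ifs <;> ring

/-- The sign of the exponent in `fourierCoefficient` reverses the order of the coefficients. -/
lemma fourierCoefficient_evalAt {k : ℕ} (a : AddMonoidAlgebra ℂ (Fin k → ℤ)) (j : Fin k → ℤ) :
    fourierCoefficient (fun θ => evalAt θ a) j = a.coeff (-j) := by
  have h := integral_evalAt (-π) (a * AddMonoidAlgebra.single j 1)
  simp only [map_mul, evalAt_single, one_mul, show -π + 2 * π = π by ring,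
    AddMonoidAlgebra.coeff_mul_single_apply, mul_one, zero_add] at h
  have hpi : (2 * π : ℂ) ^ k ≠ 0 := pow_ne_zero _ (by simp [Real.pi_ne_zero])
  rw [fourierCoefficient, h]
  field_simp

lemma exists_evalAt_eq {k : ℕ} {r : Fin k → ℕ} {f : (Fin k → ℝ) → ℂ}
    (hf : IsTrigPolynomial r f) :
    ∃ a : AddMonoidAlgebra ℂ (Fin k → ℤ), f = fun θ => evalAt θ a := by
  obtain ⟨c, hc⟩ := hf
  exact ⟨∑ j ∈ Fintype.piFinset fun t => Finset.Icc (-(r t : ℤ)) (r t : ℤ),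
    AddMonoidAlgebra.single j (c j), funext fun θ => by simp only [hc, map_sum, evalAt_single]⟩

/-- The Laurent polynomial `∑ a_j z^{-j}`. -/
noncomputable def reflect {k : ℕ} (a : AddMonoidAlgebra ℂ (Fin k → ℤ)) :
    AddMonoidAlgebra ℂ (Fin k → ℤ) :=
  ∑ j ∈ a.coeff.support, AddMonoidAlgebra.single (-j) (a.coeff j)

lemma coeff_reflect {k : ℕ} (a : AddMonoidAlgebra ℂ (Fin k → ℤ)) (j : Fin k → ℤ) :
    (reflect a).coeff j = a.coeff (-j) := by
  simp only [reflect, AddMonoidAlgebra.coeff_sum, Finsupp.finsetSum_apply,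
    AddMonoidAlgebra.coeff_single, Finsupp.single_apply, neg_eq_iff_eq_neg, Finset.sum_ite_eq',
    Finsupp.mem_support_iff]
  simp [eq_comm]

lemma evalAt_reflect {k : ℕ} {a : AddMonoidAlgebra ℂ (Fin k → ℤ)}
    (ha : ∀ j, star (a.coeff j) = a.coeff j) (θ : Fin k → ℝ) :
    evalAt θ (reflect a) = star (evalAt θ a) := by
  conv_rhs => rw [← AddMonoidAlgebra.sum_coeff_single a]
  simp only [Finsupp.sum, reflect, map_sum, evalAt_single, star_sum, star_mul']
  refine Finset.sum_congr rfl fun j _ => ?_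
  rw [ha]
  simp only [Complex.star_def, ← Complex.exp_conj, map_mul, Complex.conj_I, Complex.conj_ofReal,
    pairing, Pi.neg_apply, Int.cast_neg, neg_mul, Finset.sum_neg_distrib, Complex.ofReal_neg,
    mul_neg]

lemma evalAt_reflect_mul_self_pow {k : ℕ} {a : AddMonoidAlgebra ℂ (Fin k → ℤ)}
    (ha : ∀ j, star (a.coeff j) = a.coeff j) (θ : Fin k → ℝ) (s : ℕ) :
    evalAt θ ((reflect a * a) ^ s) = ((‖evalAt θ a‖ ^ (2 * s) : ℝ) : ℂ) := by
  rw [map_pow, map_mul, evalAt_reflect ha, Complex.star_def, mul_comm (starRingEnd ℂ _),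
    Complex.mul_conj', pow_mul]
  push_cast
  rfl

/-! ### The Toeplitz matrices and their flips -/

lemma toeplitz_apply {k : ℕ} (f : (Fin k → ℝ) → ℂ) (n : Fin k → ℕ) (l h : Idx n) :
    toeplitz f n l h = fourierCoefficient f (-offset l h) := by
  classical
  rw [toeplitz, Matrix.sum_apply, Finset.sum_eq_single (-offset l h)]
  · simp [kronecker, shiftMatrix, offset]
  · intro j _ hj
    obtain ⟨t, ht⟩ := Function.ne_iff.1 hj
    have : kronecker (fun t => shiftMatrix (n t) (j t)) l h = 0 := by
      simp only [kronecker, shiftMatrix, Matrix.of_apply]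
      refine Finset.prod_eq_zero (Finset.mem_univ t) (if_neg fun e => ht ?_)
      simp only [Pi.neg_apply, offset]
      omega
    rw [Matrix.smul_apply, this, smul_zero]
  · intro hnot
    refine absurd (Fintype.mem_piFinset.2 fun t => Finset.mem_Ioo.2 ?_) hnot
    have := (l t).2
    have := (h t).2
    simp only [Pi.neg_apply, offset]
    omega

lemma toeplitz_evalAt_apply {k : ℕ} (a : AddMonoidAlgebra ℂ (Fin k → ℤ)) (n : Fin k → ℕ)
    (l h : Idx n) : toeplitz (fun θ => evalAt θ a) n l h = a.coeff (offset l h) := by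
  rw [toeplitz_apply, fourierCoefficient_evalAt, neg_neg]

lemma sum_norm_coeff_offset_le {k : ℕ} (a : AddMonoidAlgebra ℂ (Fin k → ℤ)) {n : Fin k → ℕ}
    (l : Idx n) : ∑ h, ‖a.coeff (offset l h)‖ ≤ ∑ j ∈ a.coeff.support, ‖a.coeff j‖ := by
  classical
  calc ∑ h, ‖a.coeff (offset l h)‖ = ∑ j ∈ Finset.univ.image (offset l), ‖a.coeff j‖ :=
        (Finset.sum_image (f := fun j => ‖a.coeff j‖)
          fun _ _ _ _ e => offset_injective l e).symm
    _ ≤ ∑ j ∈ a.coeff.support ∪ Finset.univ.image (offset l), ‖a.coeff j‖ :=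
        Finset.sum_le_sum_of_subset_of_nonneg Finset.subset_union_right
          fun _ _ _ => norm_nonneg _
    _ = _ := (Finset.sum_subset Finset.subset_union_left fun j _ hj => by
        rw [Finsupp.notMem_support_iff.1 hj, norm_zero]).symm

lemma exists_abs_le_of_coeff_ne_zero {k : ℕ} (a : AddMonoidAlgebra ℂ (Fin k → ℤ)) :
    ∃ R : ℕ, ∀ j, a.coeff j ≠ 0 → ∀ t, |j t| ≤ R := by
  refine ⟨∑ j ∈ a.coeff.support, ∑ t, (j t).natAbs, fun j hj t => ?_⟩
  have h1 : (j t).natAbs ≤ ∑ t, (j t).natAbs :=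
    Finset.single_le_sum (f := fun t => (j t).natAbs) (fun _ _ => Nat.zero_le _)
      (Finset.mem_univ t)
  have h2 := Finset.single_le_sum (f := fun j : Fin k → ℤ => ∑ t, (j t).natAbs)
    (fun _ _ => Nat.zero_le _) (Finsupp.mem_support_iff.2 hj)
  rw [Int.abs_eq_natAbs]
  exact_mod_cast h1.trans h2

lemma isEssentiallyToeplitz_of_apply {k : ℕ} {A : (n : Fin k → ℕ) → Matrix (Idx n) (Idx n) ℂ}
    {a : AddMonoidAlgebra ℂ (Fin k → ℤ)} {R : ℕ} (hR : ∀ j, a.coeff j ≠ 0 → ∀ t, |j t| ≤ R)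
    (hA : ∀ n l h, A n l h = a.coeff (offset l h)) :
    IsEssentiallyToeplitz A a R (∑ j ∈ a.coeff.support, ‖a.coeff j‖) where
  abs_le_of_coeff_ne_zero := hR
  apply_interior n l h _ := hA n l h
  banded n l h hne := hR _ (by rwa [← hA])
  row_sum_le n l := by
    simp only [hA]
    exact sum_norm_coeff_offset_le a l

lemma transpose_multiAntiIdentity {k : ℕ} (n : Fin k → ℕ) :
    (multiAntiIdentity n).transpose = multiAntiIdentity n := by
  ext l h
  simp only [Matrix.transpose_apply, multiAntiIdentity, kronecker, antiIdentity, Matrix.of_apply]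
  refine Finset.prod_congr rfl fun t _ => ?_
  have : l t = (h t).rev ↔ h t = (l t).rev := by
    constructor <;> intro e <;> rw [e, Fin.rev_rev]
  simp only [this]

lemma multiAntiIdentity_mul_self {k : ℕ} (n : Fin k → ℕ) :
    multiAntiIdentity n * multiAntiIdentity n = 1 := by
  ext l h
  have h1 := multiAntiIdentity_mul_apply (1 : Matrix (Idx n) (Idx n) ℂ) (fun t => (l t).rev) h
  have h2 : (fun t => ((l t).rev).rev) = l := funext fun t => Fin.rev_rev _
  rw [mul_one, h2] at h1
  rw [multiAntiIdentity_mul_apply, h1]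

lemma multiAntiIdentity_mul_toeplitz_apply {k : ℕ} (a : AddMonoidAlgebra ℂ (Fin k → ℤ))
    (n : Fin k → ℕ) (l h : Idx n) :
    (multiAntiIdentity n * toeplitz (fun θ => evalAt θ a) n) l h
      = a.coeff fun t => (l t : ℤ) + h t + 1 - n t := by
  rw [multiAntiIdentity_mul_apply, toeplitz_evalAt_apply]
  congr 1
  funext t
  have := (l t).2
  simp only [offset, Fin.val_rev]
  omega

/-- The flipped matrix is a multilevel Hankel matrix, hence symmetric. -/
lemma transpose_multiAntiIdentity_mul_toeplitz {k : ℕ} (a : AddMonoidAlgebra ℂ (Fin k → ℤ))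
    (n : Fin k → ℕ) :
    (multiAntiIdentity n * toeplitz (fun θ => evalAt θ a) n).transpose
      = multiAntiIdentity n * toeplitz (fun θ => evalAt θ a) n := by
  ext l h
  simp only [Matrix.transpose_apply, multiAntiIdentity_mul_toeplitz_apply, add_comm]

lemma isHermitian_multiAntiIdentity_mul_toeplitz {k : ℕ} {a : AddMonoidAlgebra ℂ (Fin k → ℤ)}
    (ha : ∀ j, star (a.coeff j) = a.coeff j) (n : Fin k → ℕ) :
    (multiAntiIdentity n * toeplitz (fun θ => evalAt θ a) n).IsHermitian := by
  refine Matrix.IsHermitian.ext fun l h => ?_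
  rw [multiAntiIdentity_mul_toeplitz_apply, multiAntiIdentity_mul_toeplitz_apply, ha]
  simp only [add_comm]

/-- `(Y T)² = (Y T)ᵀ (Y T) = Tᵀ Y² T = Tᵀ T`. -/
lemma sq_multiAntiIdentity_mul_toeplitz {k : ℕ} (a : AddMonoidAlgebra ℂ (Fin k → ℤ))
    (n : Fin k → ℕ) :
    (multiAntiIdentity n * toeplitz (fun θ => evalAt θ a) n) ^ 2
      = (toeplitz (fun θ => evalAt θ a) n).transpose * toeplitz (fun θ => evalAt θ a) n := by
  rw [sq]
  nth_rw 1 [← transpose_multiAntiIdentity_mul_toeplitz]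
  rw [Matrix.transpose_mul, transpose_multiAntiIdentity, Matrix.mul_assoc,
    ← Matrix.mul_assoc (multiAntiIdentity n), multiAntiIdentity_mul_self, Matrix.one_mul]

lemma isEssentiallyToeplitz_toeplitz {k : ℕ} {a : AddMonoidAlgebra ℂ (Fin k → ℤ)} {R : ℕ}
    (hR : ∀ j, a.coeff j ≠ 0 → ∀ t, |j t| ≤ R) :
    IsEssentiallyToeplitz (toeplitz fun θ => evalAt θ a) a R
      (∑ j ∈ a.coeff.support, ‖a.coeff j‖) :=
  isEssentiallyToeplitz_of_apply hR (toeplitz_evalAt_apply a)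

lemma isEssentiallyToeplitz_gram_pow {k : ℕ} {a : AddMonoidAlgebra ℂ (Fin k → ℤ)} {R : ℕ}
    (hR : ∀ j, a.coeff j ≠ 0 → ∀ t, |j t| ≤ R) (s : ℕ) :
    ∃ (S : ℕ) (C : ℝ), 0 ≤ C ∧ IsEssentiallyToeplitz
      (fun n => ((toeplitz (fun θ => evalAt θ a) n).transpose *
        toeplitz (fun θ => evalAt θ a) n) ^ s) ((reflect a * a) ^ s) S C := by
  have hT : IsEssentiallyToeplitz (fun n => (toeplitz (fun θ => evalAt θ a) n).transpose)
      (reflect a) R _ := isEssentiallyToeplitz_of_apply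
    (fun j hj t => by rw [coeff_reflect] at hj; simpa using hR _ hj t)
    (fun n l h => by
      rw [Matrix.transpose_apply, toeplitz_evalAt_apply, coeff_reflect]
      congr 1
      funext t
      simp [offset])
  have h0 : ∀ b : AddMonoidAlgebra ℂ (Fin k → ℤ),
      0 ≤ ∑ j ∈ b.coeff.support, ‖b.coeff j‖ := fun b =>
    Finset.sum_nonneg fun _ _ => norm_nonneg _
  have h1 := mul_nonneg (h0 (reflect a)) (h0 a)
  exact ⟨_, _, pow_nonneg h1 s,
    ((hT.mul (h0 a) (isEssentiallyToeplitz_toeplitz hR)).pow h1 s)⟩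

lemma tendsto_trace_pow_even {k : ℕ} (a : AddMonoidAlgebra ℂ (Fin k → ℤ)) (s : ℕ) :
    Filter.Tendsto (fun n : Fin k → ℕ => (1 / (size n : ℂ)) *
      ((multiAntiIdentity n * toeplitz (fun θ => evalAt θ a) n) ^ (2 * s)).trace) Filter.atTop
      (nhds (((reflect a * a) ^ s).coeff 0)) := by
  obtain ⟨R, hR⟩ := exists_abs_le_of_coeff_ne_zero a
  obtain ⟨S, C, -, h⟩ := isEssentiallyToeplitz_gram_pow hR s
  simp only [pow_mul, sq_multiAntiIdentity_mul_toeplitz]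
  exact h.tendsto_trace

lemma tendsto_trace_pow_odd {k : ℕ} (hk : 1 ≤ k) (a : AddMonoidAlgebra ℂ (Fin k → ℤ)) (s : ℕ) :
    Filter.Tendsto (fun n : Fin k → ℕ => (1 / (size n : ℂ)) *
      ((multiAntiIdentity n * toeplitz (fun θ => evalAt θ a) n) ^ (2 * s + 1)).trace)
      Filter.atTop (nhds 0) := by
  obtain ⟨R, hR⟩ := exists_abs_le_of_coeff_ne_zero a
  obtain ⟨S, C, hC, h⟩ := isEssentiallyToeplitz_gram_pow hR s
  have e : ∀ n : Fin k → ℕ, (multiAntiIdentity n * toeplitz (fun θ => evalAt θ a) n) ^ (2 * s + 1)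
      = multiAntiIdentity n * (toeplitz (fun θ => evalAt θ a) n *
        ((toeplitz (fun θ => evalAt θ a) n).transpose *
          toeplitz (fun θ => evalAt θ a) n) ^ s) := fun n => by
    rw [pow_succ', pow_mul, sq_multiAntiIdentity_mul_toeplitz, Matrix.mul_assoc]
  simp only [e]
  exact ((isEssentiallyToeplitz_toeplitz hR).mul hC h).tendsto_trace_antiIdentity_mul hk

/-! ### Eigenvalues of Hermitian matrices -/

lemma sum_eigenvalues_pow {ι : Type*} [Fintype ι] [DecidableEq ι] {A : Matrix ι ι ℂ}
    (hA : A.IsHermitian) (m : ℕ) :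
    ∑ i, (hA.eigenvalues i : ℂ) ^ m = (A ^ m).trace := by
  conv_rhs => rw [hA.spectral_theorem, ← map_pow, Unitary.conjStarAlgAut_apply,
    Matrix.trace_mul_cycle, Matrix.diagonal_pow, Matrix.trace]
  simp

lemma abs_eigenvalues_le_of_row_sum_le {ι : Type*} [Fintype ι] [DecidableEq ι]
    {A : Matrix ι ι ℂ} (hA : A.IsHermitian) {C : ℝ} (hC : ∀ i, ∑ j, ‖A i j‖ ≤ C) (i : ι) :
    |hA.eigenvalues i| ≤ C := by
  have hev : Module.End.HasEigenvalue (Matrix.toLin' A) (hA.eigenvalues i : ℂ) := by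
    refine Module.End.hasEigenvalue_of_hasEigenvector
      (x := (hA.eigenvectorBasis i).ofLp) (Module.End.hasEigenvector_iff.2 ⟨?_, ?_⟩)
    · rw [Module.End.mem_eigenspace_iff, Matrix.toLin'_apply, hA.mulVec_eigenvectorBasis]
      funext j
      simp
    · intro h
      exact hA.eigenvectorBasis.orthonormal.ne_zero i (by ext j; exact congrFun h j)
  obtain ⟨l, hl⟩ := eigenvalue_mem_ball hev
  have h1 : ‖(hA.eigenvalues i : ℂ)‖ ≤ ‖A l l‖ + ∑ j ∈ Finset.univ.erase l, ‖A l j‖ := by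
    have := norm_le_norm_add_norm_sub' (hA.eigenvalues i : ℂ) (A l l)
    rw [mem_closedBall_iff_norm] at hl
    linarith
  rw [Finset.add_sum_erase _ (fun j => ‖A l j‖) (Finset.mem_univ l), Complex.norm_real] at h1
  exact h1.trans (hC l)

/-! ### From moments to continuous test functions -/

/-- Method of moments: averages over finite families of uniformly bounded real numbers that
converge for every monomial converge for every continuous function. -/
lemma tendsto_average_of_moments {ι X : Type*} [MeasurableSpace X] {l : Filter ι} {J : ι → Type*}
    [∀ i, Fintype (J i)] {x : (i : ι) → J i → ℝ} {M : ℝ} (hx : ∀ i j, |x i j| ≤ M)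
    {μ : MeasureTheory.Measure X} [MeasureTheory.IsFiniteMeasure μ] {g : X → ℝ}
    (hg : Measurable g) (hgM : ∀ᵐ y ∂μ, |g y| ≤ M)
    (hmom : ∀ m : ℕ, Filter.Tendsto (fun i => (1 / (Fintype.card (J i) : ℝ)) * ∑ j, x i j ^ m) l
      (nhds ((1 / (μ Set.univ).toReal) * ∫ y, g y ^ m ∂μ)))
    {G : ℝ → ℝ} (hG : Continuous G) :
    Filter.Tendsto (fun i => (1 / (Fintype.card (J i) : ℝ)) * ∑ j, G (x i j)) l
      (nhds ((1 / (μ Set.univ).toReal) * ∫ y, G (g y) ∂μ)) := by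
  have hint : ∀ H : ℝ → ℝ, Continuous H → MeasureTheory.Integrable (fun y => H (g y)) μ := by
    intro H hH
    obtain ⟨B, hB⟩ := (isCompact_Icc (a := -M) (b := M)).exists_bound_of_continuousOn
      hH.continuousOn
    refine MeasureTheory.Integrable.of_bound
      (hH.measurable.comp hg).aestronglyMeasurable B ?_
    filter_upwards [hgM] with y hy using hB _ (abs_le.1 hy)
  have hpoly : ∀ p : Polynomial ℝ,
      Filter.Tendsto (fun i => (1 / (Fintype.card (J i) : ℝ)) * ∑ j, p.eval (x i j)) l
        (nhds ((1 / (μ Set.univ).toReal) * ∫ y, p.eval (g y) ∂μ)) := by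
    intro p
    induction p using Polynomial.induction_on' with
    | add p q hp hq =>
      simp only [Polynomial.eval_add, Finset.sum_add_distrib, mul_add]
      rw [MeasureTheory.integral_add (hint _ p.continuous) (hint _ q.continuous), mul_add]
      exact hp.add hq
    | monomial m c =>
      have h := (hmom m).const_mul c
      simp only [Polynomial.eval_monomial, ← Finset.mul_sum, MeasureTheory.integral_const_mul]
      convert h using 2 <;> ring
  have hsum : ∀ (H : ℝ → ℝ) (ε : ℝ), 0 ≤ ε → (∀ y ∈ Set.Icc (-M) M, |H y| ≤ ε) →
      ∀ i, |(1 / (Fintype.card (J i) : ℝ)) * ∑ j, H (x i j)| ≤ ε := by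
    intro H ε hε hH i
    have h1 : |∑ j, H (x i j)| ≤ Fintype.card (J i) * ε := by
      refine (Finset.abs_sum_le_sum_abs _ _).trans
        ((Finset.sum_le_sum fun j _ => hH _ (abs_le.1 (hx i j))).trans ?_)
      rw [Finset.sum_const, nsmul_eq_mul, Finset.card_univ]
    rw [abs_mul, abs_of_nonneg (by positivity), one_div]
    exact inv_mul_le_of_le_mul₀ (by positivity) hε h1
  have hlim : ∀ (H : ℝ → ℝ) (ε : ℝ), 0 ≤ ε → (∀ y ∈ Set.Icc (-M) M, |H y| ≤ ε) →
      |(1 / (μ Set.univ).toReal) * ∫ y, H (g y) ∂μ| ≤ ε := by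
    intro H ε hε hH
    have h1 : |∫ y, H (g y) ∂μ| ≤ (μ Set.univ).toReal * ε := by
      have := MeasureTheory.norm_integral_le_of_norm_le_const (μ := μ) (f := fun y => H (g y))
        (C := ε) (by filter_upwards [hgM] with y hy using hH _ (abs_le.1 hy))
      rwa [mul_comm] at this
    rw [abs_mul, abs_of_nonneg (by positivity), one_div]
    exact inv_mul_le_of_le_mul₀ (by positivity) hε h1
  rw [Metric.tendsto_nhds]
  intro ε hε
  obtain ⟨p, hp⟩ := exists_polynomial_near_of_continuousOn (-M) M G hG.continuousOn (ε / 4)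
    (by positivity)
  filter_upwards [Metric.tendsto_nhds.1 (hpoly p) (ε / 4) (by positivity)] with i hi
  have hp' : ∀ y ∈ Set.Icc (-M) M, |p.eval y - G y| ≤ ε / 4 := fun y hy => (hp y hy).le
  have h1 := hsum (fun y => p.eval y - G y) (ε / 4) (by positivity) hp' i
  have h2 := hlim (fun y => p.eval y - G y) (ε / 4) (by positivity) hp'
  rw [MeasureTheory.integral_sub (hint _ p.continuous) (hint _ hG), mul_sub] at h2
  rw [Finset.sum_sub_distrib, mul_sub] at h1
  rw [Real.dist_eq] at hi ⊢
  rw [abs_le] at h1 h2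
  rw [abs_lt] at hi ⊢
  constructor <;> linarith

/-! ### The limit function -/

lemma measurable_psi {k : ℕ} {g : (Fin k → ℝ) → ℝ} (hg : Measurable g) : Measurable (psi g) :=
  Measurable.ite measurableSet_Icc hg (by fun_prop)

lemma abs_psi_le {k : ℕ} {g : (Fin k → ℝ) → ℝ} {M : ℝ} (hg : ∀ θ, |g θ| ≤ M)
    (θ : Fin k → ℝ) : |psi g θ| ≤ M := by
  unfold psi
  split_ifs
  · exact hg _
  · rw [abs_neg]; exact hg _

lemma isCompact_psiDomain (k : ℕ) : IsCompact (psiDomain k) := isCompact_Icc.union isCompact_Icc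

/-- The two cubes of the domain only share the origin, a null set as `k ≥ 1`; the substitution
`θ ↦ θ + (2π, …, 2π)` maps the first one to the second. -/
lemma integral_comp_psi {k : ℕ} (hk : 1 ≤ k) {g : (Fin k → ℝ) → ℝ} (hg : Continuous g)
    {G : ℝ → ℝ} (hG : Continuous G) :
    ∫ θ in psiDomain k, G (psi g θ)
      = (∫ θ in Set.Icc (fun _ : Fin k => (0 : ℝ)) (fun _ => 2 * π), G (g θ))
        + ∫ θ in Set.Icc (fun _ : Fin k => (0 : ℝ)) (fun _ => 2 * π), G (-g θ) := by
  have : Nonempty (Fin k) := ⟨⟨0, hk⟩⟩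
  have hzero : MeasureTheory.volume ({0} : Set (Fin k → ℝ)) = 0 :=
    MeasureTheory.measure_singleton _
  have hinter : ∀ θ : Fin k → ℝ, θ ∈ Set.Icc (fun _ : Fin k => -(2 * π)) (fun _ => 0) →
      θ ∈ Set.Icc (fun _ : Fin k => (0 : ℝ)) (fun _ => 2 * π) → θ = 0 :=
    fun θ h1 h2 => le_antisymm h1.2 h2.1
  have hpos : Set.EqOn (fun θ => G (psi g θ)) (fun θ => G (g θ))
      (Set.Icc (fun _ : Fin k => (0 : ℝ)) (fun _ => 2 * π)) := fun θ hθ => by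
    simp only [psi, if_pos hθ]
  have hneg : ∀ᵐ θ : Fin k → ℝ, θ ∈ Set.Icc (fun _ : Fin k => -(2 * π)) (fun _ => 0) →
      G (psi g θ) = G (-g (θ + fun _ => 2 * π)) := by
    have h0 : ∀ᵐ θ : Fin k → ℝ, θ ≠ 0 := MeasureTheory.measure_eq_zero_iff_ae_notMem.1 hzero
    filter_upwards [h0] with θ hne hθ
    rw [psi, if_neg fun h => hne (hinter θ hθ h)]
    rfl
  have hcg : Continuous fun θ : Fin k → ℝ => G (-g (θ + fun _ => 2 * π)) := by fun_prop
  have hint1 : MeasureTheory.IntegrableOn (fun θ => G (psi g θ))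
      (Set.Icc (fun _ : Fin k => -(2 * π)) (fun _ => 0)) :=
    (hcg.continuousOn.integrableOn_compact isCompact_Icc).congr_fun_ae
      (((MeasureTheory.ae_restrict_iff' measurableSet_Icc).2 hneg).mono fun _ h => h.symm)
  have hint2 : MeasureTheory.IntegrableOn (fun θ => G (psi g θ))
      (Set.Icc (fun _ : Fin k => (0 : ℝ)) (fun _ => 2 * π)) :=
    ((hG.comp hg).continuousOn.integrableOn_compact isCompact_Icc).congr_fun
      hpos.symm measurableSet_Icc
  rw [psiDomain, MeasureTheory.setIntegral_union₀ _ measurableSet_Icc.nullMeasurableSet hint1 hint2,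
    MeasureTheory.setIntegral_congr_fun measurableSet_Icc hpos,
    MeasureTheory.setIntegral_congr_ae measurableSet_Icc hneg, add_comm]
  · congr 1
    have hpre : (fun θ : Fin k → ℝ => θ + fun _ => 2 * π) ⁻¹'
        (Set.Icc (fun _ : Fin k => (0 : ℝ)) (fun _ => 2 * π))
        = Set.Icc (fun _ : Fin k => -(2 * π)) (fun _ => 0) := by
      ext θ
      simp only [Set.mem_preimage, Set.mem_Icc, Pi.le_def, Pi.add_apply]
      refine and_congr (forall_congr' fun t => ?_) (forall_congr' fun t => ?_) <;>
        constructor <;> intro h <;> linarith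
    rw [← hpre]
    exact (MeasureTheory.measurePreserving_add_right MeasureTheory.volume
      (fun _ : Fin k => 2 * π)).setIntegral_preimage_emb
        (measurableEmbedding_addRight _) (fun θ => G (-g θ)) _
  · exact MeasureTheory.measure_mono_null (fun θ h => hinter θ h.1 h.2) hzero

lemma volume_psiDomain_toReal {k : ℕ} (hk : 1 ≤ k) :
    (MeasureTheory.volume (psiDomain k)).toReal = 2 * (2 * π) ^ k := by
  have h := integral_comp_psi (g := fun _ => 0) hk continuous_const
    (continuous_const (y := (1 : ℝ)))
  have hle : (fun _ : Fin k => (0 : ℝ)) ≤ fun _ => 2 * π := fun _ => by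
    have := Real.pi_pos
    positivity
  simp only [MeasureTheory.setIntegral_const, MeasureTheory.Measure.real, smul_eq_mul, mul_one,
    Real.volume_Icc_pi_toReal hle, sub_zero, Finset.prod_const, Finset.card_univ,
    Fintype.card_fin] at h
  rw [h]
  ring

/-- The moments of the limit function: the two cubes contribute equally to the even ones and cancel
in the odd ones. -/
lemma moment_psi {k : ℕ} (hk : 1 ≤ k) {a : AddMonoidAlgebra ℂ (Fin k → ℤ)}
    (ha : ∀ j, star (a.coeff j) = a.coeff j) (s : ℕ) :
    (((1 / (MeasureTheory.volume (psiDomain k)).toReal) *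
        ∫ θ in psiDomain k, psi (fun θ => ‖evalAt θ a‖) θ ^ (2 * s) : ℝ) : ℂ)
      = ((reflect a * a) ^ s).coeff 0 ∧
    (1 / (MeasureTheory.volume (psiDomain k)).toReal) *
        ∫ θ in psiDomain k, psi (fun θ => ‖evalAt θ a‖) θ ^ (2 * s + 1) = 0 := by
  have hc : Continuous fun θ : Fin k → ℝ => ‖evalAt θ a‖ := (continuous_evalAt a).norm
  constructor
  · rw [integral_comp_psi hk hc (continuous_pow (2 * s)), volume_psiDomain_toReal hk]
    have h := integral_evalAt 0 ((reflect a * a) ^ s)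
    simp only [evalAt_reflect_mul_self_pow ha, zero_add, integral_complex_ofReal] at h
    simp only [(even_two_mul s).neg_pow, ← two_mul]
    have hpi : (2 * π : ℂ) ^ k ≠ 0 := pow_ne_zero _ (by simp [Real.pi_ne_zero])
    rw [Complex.ofReal_mul, Complex.ofReal_mul 2, h]
    push_cast
    field_simp
  · rw [integral_comp_psi hk hc (continuous_pow (2 * s + 1))]
    simp only [(odd_two_mul_add_one s).neg_pow, MeasureTheory.integral_neg, add_neg_cancel,
      mul_zero]

lemma tendsto_moment_eigenvalues {k : ℕ} (hk : 1 ≤ k) {a : AddMonoidAlgebra ℂ (Fin k → ℤ)}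
    (ha : ∀ j, star (a.coeff j) = a.coeff j) (m : ℕ) :
    Filter.Tendsto (fun n : Fin k → ℕ => (1 / (Fintype.card (Idx n) : ℝ)) *
      ∑ l, (isHermitian_multiAntiIdentity_mul_toeplitz ha n).eigenvalues l ^ m) Filter.atTop
      (nhds ((1 / (MeasureTheory.volume (psiDomain k)).toReal) *
        ∫ θ in psiDomain k, psi (fun θ => ‖evalAt θ a‖) θ ^ m)) := by
  rw [← Filter.tendsto_ofReal_iff]
  have e : ∀ n : Fin k → ℕ, (((1 / (Fintype.card (Idx n) : ℝ)) *
      ∑ l, (isHermitian_multiAntiIdentity_mul_toeplitz ha n).eigenvalues l ^ m : ℝ) : ℂ)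
      = (1 / (size n : ℂ)) *
        ((multiAntiIdentity n * toeplitz (fun θ => evalAt θ a) n) ^ m).trace := fun n => by
    rw [← sum_eigenvalues_pow (isHermitian_multiAntiIdentity_mul_toeplitz ha n)]
    simp [size, Fintype.card_pi]
  simp only [e]
  obtain ⟨s, rfl | rfl⟩ := m.even_or_odd'
  · rw [(moment_psi hk ha s).1]
    exact tendsto_trace_pow_even a s
  · rw [(moment_psi hk ha s).2]
    exact tendsto_trace_pow_odd hk a s

end MultilevelToeplitz

theorem theorem3p3 (k : ℕ) (hk : 1 ≤ k) (r : Fin k → ℕ) (f : (Fin k → ℝ) → ℂ)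
    (hf : MultilevelToeplitz.IsTrigPolynomial r f)
    (hreal : MultilevelToeplitz.HasRealFourierCoefficients f) :
    MultilevelToeplitz.HasEigenvalueDistribution
      (fun n : Fin k → ℕ =>
        MultilevelToeplitz.multiAntiIdentity n * MultilevelToeplitz.toeplitz f n)
      (fun θ => ((MultilevelToeplitz.psi (fun θ' => ‖f θ'‖) θ : ℝ) : ℂ))
      (MultilevelToeplitz.psiDomain k) := by
  open MultilevelToeplitz in
  obtain ⟨a, rfl⟩ := exists_evalAt_eq hf
  have ha : ∀ j, star (a.coeff j) = a.coeff j := fun j => by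
    obtain ⟨x, hx⟩ := hreal (-j)
    rw [fourierCoefficient_evalAt, neg_neg] at hx
    rw [hx, Complex.star_def, Complex.conj_ofReal]
  have hpsi : Measurable (psi fun θ : Fin k → ℝ => ‖evalAt θ a‖) :=
    measurable_psi (continuous_evalAt a).norm.measurable
  have hvol := volume_psiDomain_toReal hk
  have hfin : MeasureTheory.volume (psiDomain k) < ⊤ := (isCompact_psiDomain k).measure_lt_top
  refine ⟨(isCompact_psiDomain k).measurableSet.nullMeasurableSet, ?_, hfin,
    (Complex.measurable_ofReal.comp hpsi).aemeasurable, fun F hF _ => ?_⟩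
  · refine (ENNReal.toReal_pos_iff.1 ?_).1
    rw [hvol]
    have := Real.pi_pos
    positivity
  have : Fact (MeasureTheory.volume (psiDomain k) < ⊤) := ⟨hfin⟩
  have hbound : ∀ θ : Fin k → ℝ, |psi (fun θ => ‖evalAt θ a‖) θ|
      ≤ ∑ j ∈ a.coeff.support, ‖a.coeff j‖ :=
    abs_psi_le fun θ => by rw [abs_norm]; exact norm_evalAt_le a θ
  have heig : ∀ (n : Fin k → ℕ) (l : Idx n),
      |(isHermitian_multiAntiIdentity_mul_toeplitz ha n).eigenvalues l|
        ≤ ∑ j ∈ a.coeff.support, ‖a.coeff j‖ := fun n =>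
    abs_eigenvalues_le_of_row_sum_le _ fun l => by
      simp only [multiAntiIdentity_mul_apply, toeplitz_evalAt_apply]
      exact sum_norm_coeff_offset_le a _
  have key : ∀ G : ℝ → ℝ, Continuous G → _ := fun G hG =>
    tendsto_average_of_moments (μ := MeasureTheory.volume.restrict (psiDomain k)) heig hpsi
      (Filter.Eventually.of_forall hbound)
      (by simpa only [MeasureTheory.Measure.restrict_apply_univ] using
        tendsto_moment_eigenvalues hk ha) hG
  simp only [MeasureTheory.Measure.restrict_apply_univ] at key
  -- The real and the imaginary part of `F` are treated separately, on the real line.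
  have hre := key (fun x => (F x).re) (by fun_prop)
  have him := key (fun x => (F x).im) (by fun_prop)
  have hlim := ((Complex.continuous_ofReal.tendsto _).comp hre).add
    (((Complex.continuous_ofReal.tendsto _).comp him).mul_const Complex.I)
  have hint : MeasureTheory.Integrable
      (fun θ => F (psi (fun θ => ‖evalAt θ a‖) θ : ℝ))
      (MeasureTheory.volume.restrict (psiDomain k)) := by
    obtain ⟨B, hB⟩ := (isCompact_Icc (a := -∑ j ∈ a.coeff.support, ‖a.coeff j‖)
      (b := ∑ j ∈ a.coeff.support, ‖a.coeff j‖)).exists_bound_of_continuousOn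
      (f := fun x : ℝ => F x) (by fun_prop)
    exact MeasureTheory.Integrable.of_bound
      (hF.measurable.comp (Complex.measurable_ofReal.comp hpsi)).aestronglyMeasurable B
      (Filter.Eventually.of_forall fun θ => hB _ (abs_le.1 (hbound θ)))
  have hsplit : (∫ θ in psiDomain k, F (psi (fun θ => ‖evalAt θ a‖) θ : ℝ))
      = ((∫ θ in psiDomain k, (F (psi (fun θ => ‖evalAt θ a‖) θ : ℝ)).re : ℝ) : ℂ)
        + ((∫ θ in psiDomain k, (F (psi (fun θ => ‖evalAt θ a‖) θ : ℝ)).im : ℝ) : ℂ)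
          * Complex.I :=
    (integral_re_add_im hint).symm
  rw [hsplit]
  convert hlim using 2 with n
  · have hroots := (isHermitian_multiAntiIdentity_mul_toeplitz ha n).roots_charpoly_eq_eigenvalues
    have hcard : Fintype.card (Idx n) = size n := by simp [size, Fintype.card_pi]
    have hsum : ((Finset.univ.val : Multiset (Idx n)).map fun l =>
        F ((isHermitian_multiAntiIdentity_mul_toeplitz ha n).eigenvalues l : ℂ)).sum
        = ∑ l, F ((isHermitian_multiAntiIdentity_mul_toeplitz ha n).eigenvalues l : ℂ) := rfl
    rw [hroots, Multiset.map_map]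
    refine (congrArg (1 / (size n : ℂ) * ·) hsum).trans ?_
    simp only [Function.comp_apply, hcard]
    push_cast
    rw [mul_assoc, ← mul_add, Finset.sum_mul, ← Finset.sum_add_distrib]
    simp only [Complex.re_add_im]
  · push_cast
    ring
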